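/- **Setting.** Let $K\ge D>1$ and $m\ge 1$ be integers, let $N=D+1$, and let $\mathbb F_q$ be a finite field with $q$ elements. Each of $N$ non-colluding servers stores the same $K$ messages $X_1,\dots,X_K$, which are independent and uniformly distributed over $\mathbb F_q^m$; put $B=m\log_2 q$. The index set $W$ of the demand is uniformly distributed over the $D$-subsets of $\{1,\dots,K\}$ and is independent of the messages. A (scalar-)linear MPIR (multi-message private information retrieval) protocol assigns to each $W$ a joint probability law of queries $Q_1^{[W]},\dots,Q_N^{[W]}$, drawn independently of the messages; each query $Q_n^{[W]}$ is a finite, possibly empty, list of coefficient vectors in $\mathbb F_q^K$, and the answer $A_n^{[W]}$ of server $n$ is the list of the corresponding linear combinations of $X_1,\dots,X_K$, which consists of $L(A_n^{[W]})=rB$ bits if the list has $r$ entries. The protocol has to satisfy * privacy: $\mathbb P(W=W^*\mid Q_n^{[W]}=Q)=\mathbb P(W=W^*)$ for every server $n$, every $D$-subset $W^*$ and every query $Q$ that server $n$ receives with positive probability; * recoverability: $H\big((X_i)_{i\in W}\mid A_1^{[W]},\dots,A_N^{[W]},Q_1^{[W]},\dots,Q_N^{[W]}\big)=0$ for every $D$-subset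 $W$. Its rate is $DB\big/\sum_{n=1}^N\mathbb E\,[L(A_n^{[W]})]$ (by privacy this does not depend on $W$), and the linear capacity is the supremum of the rates over all linear MPIR protocols. For $1\le j\le D$ let $$l_j=\frac{\operatorname{lcm}\big(\binom Dj,D\big)}{D},\qquad m_j=\frac{D\,l_j}{\binom Dj},\qquad \mathrm L=[l_1,\dots,l_D]^{\mathsf T},$$ let $\mathrm M$ be the $D\times D$ matrix whose first row is $(l_1,\dots,l_D)$, whose entry in row $j+1$ and column $j$ is $m_j/m_{j+1}$ for $1\le j\le D-1$, and whose other entries are $0$, and let $$[f_1,\dots,f_D]=\mathrm L^{\mathsf T}\mathrm M^{K-D},\qquad [g_1,\dots,g_D]=\mathrm L^{\mathsf T}(\mathrm I+\mathrm M)^{K-D}.$$ **Theorem 1.** With $N=D+1$ servers, the linear capacity satisfies the following. 1. If $q\ge 3$ (in particular, if $q>D$), it is at least $$R=\frac{D}{N-\max_{1\le j\le D} f_j/g_j}.$$ 2. If $D\ge K/2$, it is at most $$\Big(1+\frac{K-D}{DN}\Big)^{-1}.$$ 3. If $D\le K/2$, it is at most $$\left(\frac{1-1/N^{\lfloor K/D\rfloor}}{1-1/N}+\Big(\frac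 KD-\Big\lfloor\frac KD\Big\rfloor\Big)\frac1{N^{\lfloor K/D\rfloor}}\right)^{-1}.$$ -/

import Mathlib

open scoped ENNReal Matrix

noncomputable section

namespace MPIR

/-! ### Elementary discrete probability and entropy -/

/-- The probability of the event `A` under the discrete law `p`. -/
def prob {Ω : Type*} (p : PMF Ω) (A : Set Ω) : ℝ≥0∞ :=
  p.toOuterMeasure A

/-- The conditional probability `ℙ(A | B)` under `p` (meaningful when `ℙ(B) ≠ 0`). -/
def condProb {Ω : Type*} (p : PMF Ω) (A B : Set Ω) : ℝ≥0∞ :=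
  prob p (A ∩ B) / prob p B

/-- The conditional Shannon entropy `H(U | V)`, in bits, of a random variable `U` with finitely
many values given a discrete random variable `V`:
`∑_v ℙ(V = v) ∑_u -ℙ(U = u | V = v) log₂ ℙ(U = u | V = v)`. -/
def condEntropy {Ω α β : Type*} [Fintype α] (p : PMF Ω) (U : Ω → α) (V : Ω → β) : ℝ :=
  ∑' v : β, (prob p {ω | V ω = v}).toReal *
    ∑ u : α, Real.negMulLog (condProb p {ω | U ω = u} {ω | V ω = v}).toReal / Real.log 2

/-! ### Scalar-linear multi-message private information retrieval -/

/-- The possible index sets of the demand: the `D`-subsets of the `K` message indices. -/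
abbrev Demand (K D : ℕ) : Type :=
  {W : Finset (Fin K) // W.card = D}

/-- The uniform law on the demand's index sets. -/
def demandLaw {K D : ℕ} (hDK : D ≤ K) : PMF (Demand K D) :=
  haveI : Nonempty (Demand K D) := by
    obtain ⟨W, -, hW⟩ := Finset.exists_subset_card_eq (s := (Finset.univ : Finset (Fin K)))
      (n := D) (by simpa using hDK)
    exact ⟨⟨W, hW⟩⟩
  PMF.uniformOfFintype (Demand K D)

/-- The contents of the database: `K` messages, each a vector of length `m` over `F`. -/
abbrev Messages (F : Type*) (m K : ℕ) : Type _ :=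
  Fin K → Fin m → F

/-- A scalar-linear query to one server: the (possibly empty) list of the coefficient vectors of
the linear combinations of the messages which the server is asked to send. -/
abbrev Query (F : Type*) (K : ℕ) : Type _ :=
  List (Fin K → F)

variable {F : Type*} [Field F] [Fintype F] {m N K D : ℕ}

/-- The answer of a server which stores the messages `X` to the query `q`. -/
def answer (q : Query F K) (X : Messages F m K) : List (Fin m → F) :=
  q.map fun c => ∑ k, c k • X k

/-- The size `m log₂ q` of a vector in `F_q^m`, in bits. -/
def messageBits (F : Type*) [Fintype F] (m : ℕ) : ℝ≥0∞ :=
  ENNReal.ofReal (m * Real.logb 2 (Fintype.card F))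

/-- The number of bits of an answer. -/
def answerBits (a : List (Fin m → F)) : ℝ≥0∞ :=
  a.length * messageBits F m

/-- A (randomized) rule for querying the `N` servers: for each index set `W` of the demand, the
joint law of the `N` queries. -/
abbrev QueryRule (F : Type*) (N K D : ℕ) : Type _ :=
  Demand K D → PMF (Fin N → Query F K)

/-- The joint law of the queries and the messages, given the demand's index set `W`: the messages
are independent and uniform, and the queries are independent of them. -/
def lawGiven (m : ℕ) (P : QueryRule F N K D) (W : Demand K D) :
    PMF ((Fin N → Query F K) × Messages F m K) :=
  (P W).bind fun Q => (PMF.uniformOfFintype (Messages F m K)).map fun X => (Q, X)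

/-- The joint law of the uniformly random demand's index set, the queries and the messages. -/
def law (m : ℕ) (hDK : D ≤ K) (P : QueryRule F N K D) :
    PMF (Demand K D × (Fin N → Query F K) × Messages F m K) :=
  (demandLaw hDK).bind fun W => (lawGiven m P W).map fun ω => (W, ω)

/-- The privacy condition: for each server, given any query that it can receive, the conditional
law of the demand's index set is its prior law. -/
def IsPrivate (m : ℕ) (hDK : D ≤ K) (P : QueryRule F N K D) : Prop :=
  ∀ (n : Fin N) (W : Demand K D) (q : Query F K),
    prob (law m hDK P) {ω | ω.2.1 n = q} ≠ 0 →
      condProb (law m hDK P) {ω | ω.1 = W} {ω | ω.2.1 n = q} =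
        prob (law m hDK P) {ω | ω.1 = W}

/-- The recoverability condition `H(X_W | A^[W], Q^[W]) = 0`, for each demand's index set `W`. -/
def IsRecoverable (m : ℕ) (P : QueryRule F N K D) : Prop :=
  ∀ W : Demand K D,
    condEntropy (lawGiven m P W)
      (fun ω => fun k : {k // k ∈ W.1} => ω.2 k.1)
      (fun ω => ((fun n => answer (ω.1 n) ω.2), ω.1)) = 0

/-- The expected total number of bits downloaded from the servers for the demand `X_W`. -/
def expectedDownload (m : ℕ) (P : QueryRule F N K D) (W : Demand K D) : ℝ≥0∞ :=
  ∑' ω, lawGiven m P W ω * ∑ n, answerBits (answer (ω.1 n) ω.2)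

/-- The rate: the number `D m log₂ q` of bits required by the user, divided by the expected number
of downloaded bits. For a private rule the latter is the same for all demands `W`, so that taking
the largest over `W` is only a way to name this common value. -/
def rate (m : ℕ) (P : QueryRule F N K D) : ℝ≥0∞ :=
  (D * messageBits F m) / ⨆ W : Demand K D, expectedDownload m P W

/-- The linear capacity: the supremum of the rates of all private and recoverable scalar-linear
protocols, for `N` servers storing `K` messages in `F^m` and demands of size `D`. -/
def linearCapacity (F : Type*) [Field F] [Fintype F] (m N : ℕ) {K D : ℕ} (hDK : D ≤ K) : ℝ≥0∞ :=
  ⨆ (P : QueryRule F N K D) (_ : IsPrivate m hDK P) (_ : IsRecoverable m P), rate m P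

/-! ### The explicit vectors and matrices -/

/-- `l_j = lcm(binom(D,j), D) / D`. -/
def lcoef (D j : ℕ) : ℝ :=
  (Nat.lcm (D.choose j) D : ℝ) / D

/-- `m_j = D l_j / binom(D,j)`. -/
def mcoef (D j : ℕ) : ℝ :=
  D * lcoef D j / D.choose j

/-- `L = [l_1, …, l_D]ᵀ`; the coordinate `j : Fin D` stands for the index `j + 1`. -/
def Lvec (D : ℕ) : Fin D → ℝ :=
  fun j => lcoef D (j + 1)

/-- The `D × D` matrix `M` with first row `l_1, …, l_D`, with subdiagonal
`m_1 / m_2, …, m_{D-1} / m_D`, and zero elsewhere. -/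
def Mmat (D : ℕ) : Matrix (Fin D) (Fin D) ℝ :=
  Matrix.of fun i j =>
    if (i : ℕ) = 0 then lcoef D (j + 1)
    else if (i : ℕ) = j + 1 then mcoef D (j + 1) / mcoef D (j + 2)
    else 0

/-- `Fᵀ = Lᵀ M^(K-D)`. -/
def Fvec (K D : ℕ) : Fin D → ℝ :=
  Lvec D ᵥ* Mmat D ^ (K - D)

/-- `Gᵀ = Lᵀ (I + M)^(K-D)`. -/
def Gvec (K D : ℕ) : Fin D → ℝ :=
  Lvec D ᵥ* (1 + Mmat D) ^ (K - D)

end MPIR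

end

open scoped ENNReal Matrix

noncomputable section

namespace MPIR

variable {F : Type*} [Field F] [Fintype F] {m N K D : ℕ}

/-! Both bounds rest on two reformulations. Privacy says that the law of each single query does not
depend on `W` (`isPrivate_iff`). Recoverability says that every query tuple of positive probability
determines the demanded messages (`isRecoverable_iff`), so its coefficient vectors span `e_k` for
all `k ∈ W` (`single_mem_iSup_querySpan`).

Upper bounds. Let `ρ_W(T)` be the mean rank of the span of all queries for `W` once the coordinates
in `T` are erased. By recoverability `ρ_W(T) ≥ |W \ T| + ρ_W(T ∪ W)`. Comparing the joint span with
the span of each server, whose law is the same for `W` and `W'`, gives `N ρ_W(T) ≥ ρ_{W'}(T)`.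
Alternating the two inequalities along demands with as many fresh indices as possible yields a
geometric series in `1/N` (`le_meanResidualRank`), and the expected number of downloaded
combinations is at least `ρ_W(∅)`.

Lower bound. Each server is asked for at most one combination. Outside `W` all servers get the same
interference, supported on a random set `I`. Inside `W` one server gets `0` and the other `D` get
linearly independent vectors of a common support size `j`, which exist for `q ≥ 3`. Subtracting the
first answer from the others cancels the interference and recovers `X_W`. Random placements,
scalings and shifts make the law of one query depend only on its support `S`. The pair `(j, I)` has
weight proportional to `l_j (M^(K-D-|I|))_{j,j₀}`; the recursion encoded by `M` is exactly what
makes the probability depend on `|S|` alone and not on `|S ∩ W|` (`supportWeight_eq`). A query is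
empty only if `I = ∅` and the inner vector is `0`, which saves `f_{j₀}/g_{j₀}` expected downloads.
The best `j₀` gives the maximum. -/

/-! ### Discrete probability and vanishing conditional entropy -/

theorem prob_eq_zero_iff {Ω : Type*} (p : PMF Ω) (A : Set Ω) :
    prob p A = 0 ↔ ∀ ω ∈ p.support, ω ∉ A := by
  rw [prob, PMF.toOuterMeasure_apply_eq_zero_iff, Set.disjoint_left]

theorem prob_le_one {Ω : Type*} (p : PMF Ω) (A : Set Ω) : prob p A ≤ 1 := by
  rw [prob, PMF.toOuterMeasure_apply, ← p.tsum_coe]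
  exact ENNReal.tsum_le_tsum fun ω => Set.indicator_le_self _ _ ω

theorem prob_ne_top {Ω : Type*} (p : PMF Ω) (A : Set Ω) : prob p A ≠ ⊤ :=
  ((prob_le_one p A).trans_lt ENNReal.one_lt_top).ne

theorem prob_mono {Ω : Type*} (p : PMF Ω) {A B : Set Ω} (h : A ⊆ B) : prob p A ≤ prob p B :=
  MeasureTheory.measure_mono (μ := p.toOuterMeasure) h

theorem tsum_mul_comp {Ω β : Type*} (p : PMF Ω) (V : Ω → β) (f : β → ℝ≥0∞) :
    ∑' ω, p ω * f (V ω) = ∑' v, prob p {ω | V ω = v} * f v := by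
  classical
  have h (v : β) : prob p {ω | V ω = v} * f v = ∑' ω, if V ω = v then p ω * f v else 0 := by
    rw [prob, PMF.toOuterMeasure_apply, ← ENNReal.tsum_mul_right]
    refine tsum_congr fun ω => ?_
    by_cases hv : V ω = v <;> simp [hv]
  simp_rw [h]
  rw [ENNReal.tsum_comm]
  refine tsum_congr fun ω => ?_
  rw [tsum_eq_single (V ω)]
  · simp
  · intro v hv
    simp [hv.symm]

/-- All terms of the entropy are nonnegative, so it vanishes only if every conditional probability
given a value of `V` of positive probability is `0` or `1`. -/
theorem condEntropy_eq_zero_iff {Ω α β : Type*} [Fintype α] (p : PMF Ω) (U : Ω → α) (V : Ω → β) :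
    condEntropy p U V = 0 ↔
      ∀ ω ∈ p.support, ∀ ω' ∈ p.support, V ω = V ω' → U ω = U ω' := by
  have hc (A B : Set Ω) : (condProb p A B).toReal ∈ Set.Icc (0 : ℝ) 1 := by
    refine ⟨ENNReal.toReal_nonneg, ENNReal.toReal_le_of_le_ofReal zero_le_one ?_⟩
    rw [ENNReal.ofReal_one]
    exact ENNReal.div_le_of_le_mul (by simpa using prob_mono p Set.inter_subset_right)
  have hlog : 0 < Real.log 2 := Real.log_pos one_lt_two
  have hterm (u : α) (v : β) : 0 ≤
      Real.negMulLog (condProb p {ω | U ω = u} {ω | V ω = v}).toReal / Real.log 2 :=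
    div_nonneg (Real.negMulLog_nonneg (hc _ _).1 (hc _ _).2) hlog.le
  -- Without summability `∑'` would take the default value `0`, and a vanishing entropy would carry
  -- no information.
  have hsum : Summable fun v : β => (prob p {ω | V ω = v}).toReal *
      ∑ u : α, Real.negMulLog (condProb p {ω | U ω = u} {ω | V ω = v}).toReal / Real.log 2 := by
    have h1 : Summable fun v : β => (prob p {ω | V ω = v}).toReal := by
      apply ENNReal.summable_toReal
      have := tsum_mul_comp p V 1
      simp only [Pi.one_apply, mul_one, p.tsum_coe] at this
      rw [← this]
      exact ENNReal.one_ne_top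
    refine Summable.of_nonneg_of_le (fun v => mul_nonneg ENNReal.toReal_nonneg
      (Finset.sum_nonneg fun u _ => hterm u v)) (fun v => ?_)
      (h1.mul_right (∑ u : α, 1 / Real.log 2))
    gcongr with u
    have := Real.negMulLog_le_one_sub_self (hc {ω | U ω = u} {ω | V ω = v}).1
    linarith [(hc {ω | U ω = u} {ω | V ω = v}).1]
  have hnn (v : β) : 0 ≤ (prob p {ω | V ω = v}).toReal *
      ∑ u : α, Real.negMulLog (condProb p {ω | U ω = u} {ω | V ω = v}).toReal / Real.log 2 :=
    mul_nonneg ENNReal.toReal_nonneg (Finset.sum_nonneg fun u _ => hterm u v)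
  have hiff : condEntropy p U V = 0 ↔ ∀ v, (prob p {ω | V ω = v}).toReal *
      ∑ u : α, Real.negMulLog (condProb p {ω | U ω = u} {ω | V ω = v}).toReal / Real.log 2 = 0 := by
    rw [condEntropy, ← hsum.hasSum_iff, hasSum_zero_iff_of_nonneg hnn, funext_iff]
    rfl
  rw [hiff]
  constructor
  · intro h ω hω ω' hω' hV
    by_contra hU
    have hB : prob p {x | V x = V ω'} ≠ 0 := by
      rw [Ne, prob_eq_zero_iff]
      exact fun hh => hh ω' hω' rfl
    have hA : prob p ({x | U x = U ω} ∩ {x | V x = V ω'}) ≠ 0 := by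
      rw [Ne, prob_eq_zero_iff]
      exact fun hh => hh ω hω ⟨rfl, hV⟩
    have h1 := (mul_eq_zero.1 (h (V ω'))).resolve_left
      (ENNReal.toReal_ne_zero.2 ⟨hB, prob_ne_top _ _⟩)
    rw [Finset.sum_eq_zero_iff_of_nonneg fun u _ => hterm u _] at h1
    have h2 := (div_eq_zero_iff.1 (h1 (U ω) (Finset.mem_univ _))).resolve_right hlog.ne'
    have hpos : 0 < (condProb p {x | U x = U ω} {x | V x = V ω'}).toReal :=
      ENNReal.toReal_pos (by simpa [condProb] using ⟨hA, prob_ne_top _ _⟩)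
        (ENNReal.div_ne_top (prob_ne_top _ _) hB)
    have h3 : (condProb p {x | U x = U ω} {x | V x = V ω'}).toReal = 1 := by
      rw [Real.negMulLog, neg_mul, neg_eq_zero] at h2
      have := (mul_eq_zero.1 h2).resolve_left hpos.ne'
      exact Real.eq_one_of_pos_of_log_eq_zero hpos this
    have h4 : prob p ({x | U x = U ω} ∩ {x | V x = V ω'}) = prob p {x | V x = V ω'} := by
      rw [ENNReal.toReal_eq_one_iff, condProb,
        ENNReal.div_eq_one_iff hB (prob_ne_top _ _)] at h3
      exact h3
    -- The point `ω'` lies in the event on `V` but not in the one on `U`; as both sides have equal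
    -- probability by `h4`, its mass must be `0`.
    have h5 : prob p ({x | U x = U ω} ∩ {x | V x = V ω'}) + p ω' ≤ prob p {x | V x = V ω'} := by
      have : p ω' = prob p {ω'} := by rw [prob, PMF.toOuterMeasure_apply_singleton]
      rw [this, prob, prob, prob, PMF.toOuterMeasure_apply, PMF.toOuterMeasure_apply,
        PMF.toOuterMeasure_apply, ← ENNReal.tsum_add]
      refine ENNReal.tsum_le_tsum fun x => ?_
      by_cases hx : x = ω'
      · subst hx
        simp [Set.indicator, Ne.symm hU]
      · rw [Set.indicator_of_notMem (s := {ω'}) hx, add_zero]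
        exact Set.indicator_le_indicator_of_subset Set.inter_subset_right (fun _ => zero_le) x
    rw [h4] at h5
    have h6 : p ω' ≤ 0 := by
      refine (ENNReal.add_le_add_iff_left (prob_ne_top p {x | V x = V ω'})).1 ?_
      simpa using h5
    exact hω' (le_antisymm h6 zero_le)
  · intro h v
    by_cases hB : prob p {x | V x = v} = 0
    · simp [hB]
    obtain ⟨ω, hω, hv⟩ : ∃ ω ∈ p.support, V ω = v := by
      by_contra! hh
      exact hB ((prob_eq_zero_iff _ _).2 hh)
    refine mul_eq_zero_of_right _ (Finset.sum_eq_zero fun u _ => ?_)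
    by_cases hu : u = U ω
    · have : prob p ({x | U x = u} ∩ {x | V x = v}) = prob p {x | V x = v} := by
        refine PMF.toOuterMeasure_apply_eq_of_inter_support_eq p ?_
        ext x
        simp only [Set.mem_inter_iff, Set.mem_ofPred_eq]
        refine ⟨fun hx => ⟨hx.1.2, hx.2⟩, fun hx => ⟨⟨?_, hx.1⟩, hx.2⟩⟩
        rw [hu]
        exact h x hx.2 ω hω (hx.1.trans hv.symm)
      rw [condProb, this, ENNReal.div_self hB (prob_ne_top _ _)]
      simp
    · have : prob p ({x | U x = u} ∩ {x | V x = v}) = 0 := by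
        rw [prob_eq_zero_iff]
        rintro x hx ⟨hx1, hx2⟩
        exact hu (hx1.symm.trans (h x hx ω hω (Eq.trans hx2 hv.symm)))
      rw [condProb, this]
      simp

/-! ### Privacy, recoverability and download in terms of the query laws -/

theorem demand_nonempty (hDK : D ≤ K) : Nonempty (Demand K D) := by
  obtain ⟨W, -, hW⟩ := Finset.exists_subset_card_eq (s := (Finset.univ : Finset (Fin K)))
    (n := D) (by simpa using hDK)
  exact ⟨⟨W, hW⟩⟩

theorem demandLaw_apply (hDK : D ≤ K) (W : Demand K D) :
    demandLaw hDK W = (Fintype.card (Demand K D) : ℝ≥0∞)⁻¹ := by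
  simp [demandLaw]

theorem prob_lawGiven (P : QueryRule F N K D) (W : Demand K D) (A : Set (Fin N → Query F K)) :
    prob (lawGiven m P W) {ω | ω.1 ∈ A} = prob (P W) A := by
  classical
  rw [prob, lawGiven, PMF.toOuterMeasure_bind_apply, prob, PMF.toOuterMeasure_apply]
  refine tsum_congr fun Q => ?_
  rw [PMF.toOuterMeasure_map_apply]
  by_cases hQ : Q ∈ A
  · have : (fun X : Messages F m K => (Q, X)) ⁻¹' {ω | ω.1 ∈ A} = Set.univ := by
      ext X
      simp [hQ]
    rw [this, (PMF.toOuterMeasure_apply_eq_one_iff _ _).2 (Set.subset_univ _)]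
    simp [hQ]
  · have : (fun X : Messages F m K => (Q, X)) ⁻¹' {ω | ω.1 ∈ A} = ∅ := by
      ext X
      simp [hQ]
    simp [this, hQ]

/-- The event may vary with the demand, so that one formula covers both the marginal of a query and
its joint law with `W`. -/
theorem prob_law (hDK : D ≤ K) (P : QueryRule F N K D)
    (A : Demand K D → Set (Fin N → Query F K)) :
    prob (law m hDK P) {ω | ω.2.1 ∈ A ω.1} =
      ∑ W, (Fintype.card (Demand K D) : ℝ≥0∞)⁻¹ * prob (P W) (A W) := by
  rw [prob, law, PMF.toOuterMeasure_bind_apply, tsum_fintype]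
  refine Finset.sum_congr rfl fun W _ => ?_
  rw [PMF.toOuterMeasure_map_apply, demandLaw_apply, ← prob_lawGiven (m := m)]
  rfl

theorem prob_law_demand_inter (hDK : D ≤ K) (P : QueryRule F N K D) (W : Demand K D) (n : Fin N)
    (q : Query F K) :
    prob (law m hDK P) ({ω | ω.1 = W} ∩ {ω | ω.2.1 n = q}) =
      (Fintype.card (Demand K D) : ℝ≥0∞)⁻¹ * prob (P W) {Q | Q n = q} := by
  classical
  have h := prob_law (m := m) hDK P fun W' => if W' = W then {Q | Q n = q} else ∅
  rw [Finset.sum_eq_single W] at h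
  · simp only [if_true] at h
    rw [← h]
    congr 1
    ext ω
    by_cases hω : ω.1 = W <;> simp [hω]
  · intro W' _ hW'
    simp [hW', prob]
  · simp

theorem prob_law_demand (hDK : D ≤ K) (P : QueryRule F N K D) (W : Demand K D) :
    prob (law m hDK P) {ω | ω.1 = W} = (Fintype.card (Demand K D) : ℝ≥0∞)⁻¹ := by
  classical
  have h := prob_law (m := m) hDK P fun W' => if W' = W then Set.univ else ∅
  rw [Finset.sum_eq_single W] at h
  · have h1 : prob (P W) Set.univ = 1 :=
      (PMF.toOuterMeasure_apply_eq_one_iff _ _).2 (Set.subset_univ _)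
    simp only [if_true, h1, mul_one] at h
    rw [← h]
    congr 1
    ext ω
    by_cases hω : ω.1 = W <;> simp [hω]
  · intro W' _ hW'
    simp [hW', prob]
  · simp

/-- Bayes' rule for the uniform prior: `W` is independent of the query exactly when the query has
the same law for all `W`. The number of demands cancels. -/
theorem isPrivate_iff (hDK : D ≤ K) (P : QueryRule F N K D) :
    IsPrivate m hDK P ↔ ∀ (n : Fin N) (q : Query F K) (W W' : Demand K D),
      prob (P W) {Q | Q n = q} = prob (P W') {Q | Q n = q} := by
  have := demand_nonempty hDK
  have hc0 : (Fintype.card (Demand K D) : ℝ≥0∞)⁻¹ ≠ 0 :=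
    ENNReal.inv_ne_zero.2 (ENNReal.natCast_ne_top _)
  have hct : (Fintype.card (Demand K D) : ℝ≥0∞)⁻¹ ≠ ⊤ :=
    ENNReal.inv_ne_top.2 (by exact_mod_cast Fintype.card_ne_zero)
  have hsum (n : Fin N) (q : Query F K) : prob (law m hDK P) {ω | ω.2.1 n = q} =
      ∑ W, (Fintype.card (Demand K D) : ℝ≥0∞)⁻¹ * prob (P W) {Q | Q n = q} :=
    prob_law (m := m) hDK P fun _ => {Q | Q n = q}
  constructor
  · intro h n q
    -- For a query that is never received the privacy condition is void, but then its probability is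
    -- `0` for every demand.
    by_cases h0 : prob (law m hDK P) {ω | ω.2.1 n = q} = 0
    · have hz (W : Demand K D) : prob (P W) {Q | Q n = q} = 0 := by
        rw [hsum, Finset.sum_eq_zero_iff] at h0
        exact (mul_eq_zero.1 (h0 W (Finset.mem_univ _))).resolve_left hc0
      intro W W'
      rw [hz, hz]
    · have hz (W : Demand K D) :
          prob (P W) {Q | Q n = q} = prob (law m hDK P) {ω | ω.2.1 n = q} := by
        have := h n W q h0
        rw [condProb, prob_law_demand_inter, prob_law_demand] at this
        refine (ENNReal.mul_right_inj hc0 hct).1 ?_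
        conv_rhs => rw [← this]
        rw [ENNReal.div_mul_cancel h0 (prob_ne_top _ _)]
      intro W W'
      rw [hz, hz]
  · intro h n W q h0
    have hq : prob (law m hDK P) {ω | ω.2.1 n = q} = prob (P W) {Q | Q n = q} := by
      rw [hsum, Finset.sum_congr rfl fun W' _ => by rw [h n q W' W], Finset.sum_const,
        Finset.card_univ, nsmul_eq_mul, ← mul_assoc, ENNReal.mul_inv_cancel
          (by exact_mod_cast Fintype.card_ne_zero) (ENNReal.natCast_ne_top _), one_mul]
    rw [condProb, prob_law_demand_inter, prob_law_demand, ← hq,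
      ENNReal.mul_div_cancel_right h0 (prob_ne_top _ _)]

theorem mem_support_lawGiven (P : QueryRule F N K D) (W : Demand K D)
    (ω : (Fin N → Query F K) × Messages F m K) :
    ω ∈ (lawGiven m P W).support ↔ ω.1 ∈ (P W).support := by
  obtain ⟨Q, X⟩ := ω
  simp [lawGiven]

theorem expectedDownload_eq (P : QueryRule F N K D) (W : Demand K D) :
    expectedDownload m P W =
      (∑' Q, P W Q * ∑ n, ((Q n).length : ℝ≥0∞)) * messageBits F m := by
  have hlen (ω : (Fin N → Query F K) × Messages F m K) :
      ∑ n, answerBits (answer (ω.1 n) ω.2) = (∑ n, ((ω.1 n).length : ℝ≥0∞)) * messageBits F m := by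
    simp [answerBits, answer, Finset.sum_mul]
  simp_rw [expectedDownload, hlen]
  rw [tsum_mul_comp (lawGiven m P W) Prod.fst
    fun Q => (∑ n, ((Q n).length : ℝ≥0∞)) * messageBits F m, ← ENNReal.tsum_mul_right]
  refine tsum_congr fun Q => ?_
  have := prob_lawGiven (m := m) P W {Q}
  simp only [Set.mem_singleton_iff] at this
  rw [this, prob, PMF.toOuterMeasure_apply_singleton, mul_assoc]

theorem isRecoverable_iff (P : QueryRule F N K D) :
    IsRecoverable m P ↔ ∀ W, ∀ Q ∈ (P W).support, ∀ X X' : Messages F m K,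
      (∀ n, answer (Q n) X = answer (Q n) X') → ∀ k ∈ W.1, X k = X' k := by
  refine forall_congr' fun W => ?_
  rw [condEntropy_eq_zero_iff]
  constructor
  · intro h Q hQ X X' hX k hk
    exact congrFun (h (Q, X) ((mem_support_lawGiven _ _ _).2 hQ) (Q, X')
      ((mem_support_lawGiven _ _ _).2 hQ) (Prod.ext (funext hX) rfl)) ⟨k, hk⟩
  · rintro h ⟨Q, X⟩ hQ ⟨Q', X'⟩ - hV
    obtain ⟨h1, rfl⟩ := Prod.mk.inj hV
    exact funext fun k =>
      h Q ((mem_support_lawGiven _ _ _).1 hQ) X X' (congrFun h1) k.1 k.2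

/-! ### Ranks of query spans -/

/-- The span of the coefficient vectors in a query. -/
def querySpan (q : Query F K) : Submodule F (Fin K → F) :=
  Submodule.span F {c | c ∈ q}

theorem finrank_querySpan_le (q : Query F K) : Module.finrank F (querySpan q) ≤ q.length := by
  classical
  have h : {c | c ∈ q} = (q.toFinset : Set (Fin K → F)) := by
    ext c
    simp
  rw [querySpan, h]
  exact (finrank_span_finset_le_card _).trans (List.toFinset_card_le q)

/-- Otherwise a functional `φ` vanishes on the span but not at `e_k`. The database with entries
`φ(e_i)` then gives the same answers as the zero database, although the demanded message `k`
differs. -/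
theorem single_mem_iSup_querySpan {P : QueryRule F N K D} (hm : 1 ≤ m) (h : IsRecoverable m P)
    {W : Demand K D} {Q : Fin N → Query F K} (hQ : Q ∈ (P W).support) {k : Fin K} (hk : k ∈ W.1) :
    Pi.single k 1 ∈ ⨆ n, querySpan (Q n) := by
  by_contra hV
  obtain ⟨φ, hφ, hφV⟩ := Submodule.exists_dual_map_eq_bot_of_notMem hV inferInstance
  have hφV' := LinearMap.le_ker_iff_map.2 hφV
  let X : Messages F m K := fun i _ => φ (Pi.single i 1)
  refine hφ (congrFun (((isRecoverable_iff P).1 h W Q hQ X 0 (fun n => ?_)) k hk) ⟨0, hm⟩)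
  refine List.map_congr_left fun c hc => ?_
  have hc' : φ c = 0 := hφV' (Submodule.mem_iSup_of_mem n (Submodule.subset_span hc))
  ext i
  simp only [Finset.sum_apply, Pi.smul_apply, Pi.zero_apply, smul_zero, Finset.sum_const_zero, X]
  rw [← hc', LinearMap.pi_apply_eq_sum_univ φ c]
  refine Finset.sum_congr rfl fun k _ => ?_
  congr 2
  ext j
  simp [Pi.single_apply, eq_comm]

/-- The linear map which replaces the coordinates in `T` by zero. -/
def eraseCoords (F : Type*) [Field F] (T : Finset (Fin K)) : (Fin K → F) →ₗ[F] Fin K → F where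
  toFun v k := if k ∈ T then 0 else v k
  map_add' v w := by
    ext k
    by_cases h : k ∈ T <;> simp [h]
  map_smul' a v := by
    ext k
    by_cases h : k ∈ T <;> simp [h]

theorem eraseCoords_apply (T : Finset (Fin K)) (v : Fin K → F) (k : Fin K) :
    eraseCoords F T v k = if k ∈ T then 0 else v k := rfl

/-- The dimension which remains of `V` when the coordinates in `T` are known. -/
def residualRank (T : Finset (Fin K)) (V : Submodule F (Fin K → F)) : ℕ :=
  Module.finrank F (V.map (eraseCoords F T))

theorem residualRank_mono (T : Finset (Fin K)) {V V' : Submodule F (Fin K → F)} (h : V ≤ V') :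
    residualRank T V ≤ residualRank T V' :=
  Submodule.finrank_mono (Submodule.map_mono h)

theorem residualRank_iSup_le (T : Finset (Fin K)) (V : Fin N → Submodule F (Fin K → F)) :
    residualRank T (⨆ n, V n) ≤ ∑ n, residualRank T (V n) := by
  have h (s : Finset (Fin N)) :
      Module.finrank F ↥(⨆ n ∈ s, (V n).map (eraseCoords F T)) ≤ ∑ n ∈ s, residualRank T (V n) := by
    classical
    induction s using Finset.induction_on with
    | empty => simp
    | insert a s ha ih =>
      rw [Finset.iSup_insert, Finset.sum_insert ha]
      exact (Submodule.finrank_add_le_finrank_add_finrank _ _).trans (Nat.add_le_add_left ih _)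
  have h' := h Finset.univ
  have hu : ⨆ n ∈ Finset.univ, (V n).map (eraseCoords F T) = ⨆ n, (V n).map (eraseCoords F T) := by
    simp
  rwa [hu, ← Submodule.map_iSup] at h'

/-- Rank-nullity for erasing `W` from the image of `V` after `T` has been erased: the kernel
contains the independent vectors `e_k` with `k ∈ W \ T`. -/
theorem card_add_residualRank_le (T W : Finset (Fin K)) (V : Submodule F (Fin K → F))
    (h : ∀ k ∈ W, Pi.single k 1 ∈ V) :
    (W \ T).card + residualRank (T ∪ W) V ≤ residualRank T V := by
  have hcomp : eraseCoords F (T ∪ W) = eraseCoords F W ∘ₗ eraseCoords F T := by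
    ext v k
    simp only [LinearMap.comp_apply, eraseCoords_apply, Finset.mem_union]
    by_cases h1 : k ∈ T <;> by_cases h2 : k ∈ W <;> simp [h1, h2]
  set U := V.map (eraseCoords F T) with hU
  let f := (eraseCoords F W).domRestrict U
  have hrank := f.finrank_range_add_finrank_ker
  have hrange : LinearMap.range f = V.map (eraseCoords F (T ∪ W)) := by
    rw [LinearMap.range_domRestrict, hcomp, Submodule.map_comp]
  have hmem (k : ↥(W \ T)) : (Pi.single k.1 1 : Fin K → F) ∈ U := by
    obtain ⟨k, hk⟩ := k
    rw [Finset.mem_sdiff] at hk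
    refine ⟨Pi.single k 1, h k hk.1, ?_⟩
    ext j
    rw [eraseCoords_apply]
    by_cases hj : j = k
    · subst hj
      simp [hk.2]
    · simp [hj]
  have hker (k : ↥(W \ T)) : (⟨Pi.single k.1 1, hmem k⟩ : U) ∈ LinearMap.ker f := by
    obtain ⟨k, hk⟩ := k
    rw [Finset.mem_sdiff] at hk
    rw [LinearMap.mem_ker]
    ext j
    change eraseCoords F W (Pi.single k 1) j = 0
    rw [eraseCoords_apply]
    by_cases hj : j = k
    · subst hj
      simp [hk.1]
    · simp [hj]
  have hli : LinearIndependent F fun k : ↥(W \ T) =>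
      (⟨⟨Pi.single k.1 1, hmem k⟩, hker k⟩ : LinearMap.ker f) := by
    refine LinearIndependent.of_comp (U.subtype ∘ₗ (LinearMap.ker f).subtype) ?_
    convert (Pi.basisFun F (Fin K)).linearIndependent.comp (fun k : ↥(W \ T) => k.1)
      Subtype.val_injective using 1
    ext k
    simp
  have hcard := hli.fintype_card_le_finrank
  rw [Fintype.card_coe] at hcard
  rw [residualRank, residualRank, ← hrange, ← hU]
  omega

/-! ### Upper bounds on the capacity -/

/-- The expectation of `f` over the queries for the demand `W`. -/
def queryMean (P : QueryRule F N K D) (W : Demand K D) (f : (Fin N → Query F K) → ℝ≥0∞) : ℝ≥0∞ :=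
  ∑' Q, P W Q * f Q

theorem queryMean_mono (P : QueryRule F N K D) (W : Demand K D)
    {f g : (Fin N → Query F K) → ℝ≥0∞} (h : ∀ Q ∈ (P W).support, f Q ≤ g Q) :
    queryMean P W f ≤ queryMean P W g := by
  refine ENNReal.tsum_le_tsum fun Q => ?_
  by_cases hQ : P W Q = 0
  · simp [hQ]
  · exact mul_le_mul_right (h Q hQ) _

theorem queryMean_sum (P : QueryRule F N K D) (W : Demand K D)
    (f : Fin N → (Fin N → Query F K) → ℝ≥0∞) :
    queryMean P W (fun Q => ∑ n, f n Q) = ∑ n, queryMean P W (f n) := by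
  simp_rw [queryMean, Finset.mul_sum]
  exact Summable.tsum_finsetSum fun _ _ => ENNReal.summable

theorem queryMean_const_add (P : QueryRule F N K D) (W : Demand K D) (a : ℝ≥0∞)
    (f : (Fin N → Query F K) → ℝ≥0∞) :
    queryMean P W (fun Q => a + f Q) = a + queryMean P W f := by
  simp_rw [queryMean, mul_add]
  rw [ENNReal.tsum_add, ENNReal.tsum_mul_right, PMF.tsum_coe, one_mul]

theorem queryMean_comp_eq {hDK : D ≤ K} {P : QueryRule F N K D} (h : IsPrivate m hDK P) (n : Fin N)
    (f : Query F K → ℝ≥0∞) (W W' : Demand K D) :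
    queryMean P W (fun Q => f (Q n)) = queryMean P W' fun Q => f (Q n) := by
  rw [queryMean, queryMean, tsum_mul_comp (P W) (fun Q => Q n) f,
    tsum_mul_comp (P W') (fun Q => Q n) f]
  exact tsum_congr fun q => by rw [(isPrivate_iff hDK P).1 h n q W W']

/-- The mean residual rank of the span of all queries. -/
def meanResidualRank (P : QueryRule F N K D) (W : Demand K D) (T : Finset (Fin K)) : ℝ≥0∞ :=
  queryMean P W fun Q => (residualRank T (⨆ n, querySpan (Q n)) : ℝ≥0∞)

theorem card_add_meanResidualRank_le {P : QueryRule F N K D} (hm : 1 ≤ m) (h : IsRecoverable m P)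
    (W : Demand K D) (T : Finset (Fin K)) :
    (W.1 \ T).card + meanResidualRank P W (T ∪ W.1) ≤ meanResidualRank P W T := by
  rw [meanResidualRank, ← queryMean_const_add]
  refine queryMean_mono P W fun Q hQ => ?_
  exact_mod_cast card_add_residualRank_le T W.1 _
    fun k hk => single_mem_iSup_querySpan hm h hQ hk

/-- The demand may be exchanged at the price of a factor `N`: the joint rank for `W'` is at most the
sum of the servers' ranks, privacy moves each summand to `W`, and there each is at most the joint
rank. -/
theorem meanResidualRank_step {hDK : D ≤ K} {P : QueryRule F N K D} (hm : 1 ≤ m)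
    (hp : IsPrivate m hDK P) (h : IsRecoverable m P) (W W' : Demand K D) (T : Finset (Fin K)) :
    (N : ℝ≥0∞)⁻¹ * ((W'.1 \ T).card + meanResidualRank P W' (T ∪ W'.1)) ≤
      meanResidualRank P W T := by
  rw [← ENNReal.div_eq_inv_mul]
  refine ENNReal.div_le_of_le_mul' ?_
  calc _ ≤ meanResidualRank P W' T := card_add_meanResidualRank_le hm h W' T
    _ ≤ queryMean P W' (fun Q => ∑ n, (residualRank T (querySpan (Q n)) : ℝ≥0∞)) :=
      queryMean_mono P W' fun Q _ => by exact_mod_cast residualRank_iSup_le T _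
    _ = ∑ n, queryMean P W' (fun Q => (residualRank T (querySpan (Q n)) : ℝ≥0∞)) :=
      queryMean_sum P W' _
    _ = ∑ n, queryMean P W (fun Q => (residualRank T (querySpan (Q n)) : ℝ≥0∞)) :=
      Finset.sum_congr rfl fun n _ =>
        queryMean_comp_eq hp n (fun q => (residualRank T (querySpan q) : ℝ≥0∞)) W' W
    _ ≤ ∑ _n : Fin N, meanResidualRank P W T :=
      Finset.sum_le_sum fun n _ => queryMean_mono P W fun Q _ => by
        exact_mod_cast residualRank_mono T (le_iSup (fun n => querySpan (Q n)) n)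
    _ = N * meanResidualRank P W T := by simp

theorem exists_demand_le_card_sdiff (hDK : D ≤ K) (T : Finset (Fin K)) {r : ℕ} (hr : r ≤ D)
    (hT : r ≤ Tᶜ.card) : ∃ W : Demand K D, r ≤ (W.1 \ T).card := by
  obtain ⟨R, hRT, hR⟩ := Finset.exists_subset_card_eq hT
  obtain ⟨W, hRW, -, hW⟩ := Finset.exists_subsuperset_card_eq (Finset.subset_univ R)
    (hR.trans_le hr) (by simpa using hDK)
  refine ⟨⟨W, hW⟩, hR ▸ Finset.card_le_card fun k hk => Finset.mem_sdiff.2 ⟨hRW hk, ?_⟩⟩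
  exact Finset.mem_compl.1 (hRT hk)

theorem sum_geom_succ_add {R : Type*} [CommSemiring R] (a b c : R) (p : ℕ) :
    ∑ i ∈ Finset.range (p + 1), a * b ^ i + c * b ^ (p + 1) =
      a + b * (∑ i ∈ Finset.range p, a * b ^ i + c * b ^ p) := by
  rw [Finset.sum_range_succ', mul_add, Finset.mul_sum,
    Finset.sum_congr rfl fun i _ => show a * b ^ (i + 1) = b * (a * b ^ i) by ring]
  ring

/-- Each induction step passes to a demand `W'` disjoint from the known set `T` and enlarges `T` by
it; hence `W` and `T` stay general. The base case uses the last `r` fresh indices. -/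
theorem le_meanResidualRank {hDK : D ≤ K} {P : QueryRule F N K D} (hm : 1 ≤ m)
    (hp : IsPrivate m hDK P) (h : IsRecoverable m P) {r : ℕ} (hr : r ≤ D) (p : ℕ) :
    ∀ (W : Demand K D) (T : Finset (Fin K)), p * D + r ≤ Tᶜ.card →
      (N : ℝ≥0∞)⁻¹ * (∑ i ∈ Finset.range p, D * (N : ℝ≥0∞)⁻¹ ^ i + r * (N : ℝ≥0∞)⁻¹ ^ p) ≤
        meanResidualRank P W T := by
  induction p with
  | zero =>
    intro W T hT
    obtain ⟨W', hW'⟩ := exists_demand_le_card_sdiff hDK T hr (by omega)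
    refine le_trans (mul_le_mul_right ?_ _) (meanResidualRank_step hm hp h W W' T)
    simp only [Finset.range_zero, Finset.sum_empty, pow_zero, mul_one, zero_add]
    exact le_add_right (Nat.cast_le.2 hW')
  | succ p ih =>
    intro W T hT
    rw [Nat.succ_mul] at hT
    obtain ⟨W', hW'⟩ := exists_demand_le_card_sdiff hDK T le_rfl (by omega)
    refine le_trans (mul_le_mul_right ?_ _) (meanResidualRank_step hm hp h W W' T)
    have hc : p * D + r ≤ (T ∪ W'.1)ᶜ.card := by
      have h1 := Finset.card_union_le T W'.1
      have h2 := Finset.card_compl_add_card (T ∪ W'.1)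
      have h3 := Finset.card_compl_add_card T
      have h4 := W'.2
      omega
    have hi := ih W' _ hc
    rw [sum_geom_succ_add]
    exact add_le_add (Nat.cast_le.2 hW') hi

/-- The first demand is the actual `W`, so its `D` indices count in full; the factor `1/N` enters
only with the next exchange of demands. -/
theorem le_queryMean_length {hDK : D ≤ K} {P : QueryRule F N K D} (hm : 1 ≤ m)
    (hp : IsPrivate m hDK P) (h : IsRecoverable m P) {p r : ℕ} (hr : r ≤ D)
    (hK : (p + 1) * D + r = K) (W : Demand K D) :
    ∑ i ∈ Finset.range (p + 1), D * (N : ℝ≥0∞)⁻¹ ^ i + r * (N : ℝ≥0∞)⁻¹ ^ (p + 1) ≤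
      queryMean P W fun Q => ∑ n, ((Q n).length : ℝ≥0∞) := by
  have hc : p * D + r ≤ (∅ ∪ W.1)ᶜ.card := by
    have h2 := Finset.card_compl_add_card (∅ ∪ W.1)
    rw [Finset.empty_union, Fintype.card_fin, W.2] at h2
    rw [Finset.empty_union]
    rw [Nat.succ_mul] at hK
    omega
  rw [sum_geom_succ_add]
  calc _ ≤ (W.1 \ ∅).card + meanResidualRank P W (∅ ∪ W.1) :=
      add_le_add (by simp [W.2]) (le_meanResidualRank hm hp h hr p W _ hc)
    _ ≤ meanResidualRank P W ∅ := card_add_meanResidualRank_le hm h W ∅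
    _ ≤ _ := by
      refine queryMean_mono P W fun Q _ => ?_
      have : residualRank ∅ (⨆ n, querySpan (Q n)) ≤ ∑ n, (Q n).length :=
        (residualRank_iSup_le _ _).trans (Finset.sum_le_sum fun n _ =>
          (Submodule.finrank_map_le _ _).trans (finrank_querySpan_le _))
      exact_mod_cast this

theorem messageBits_pos (hm : 1 ≤ m) : 0 < messageBits F m := by
  rw [messageBits, ENNReal.ofReal_pos]
  have : (1 : ℝ) < Fintype.card F := by exact_mod_cast Fintype.one_lt_card
  have := Real.logb_pos one_lt_two this
  positivity

theorem messageBits_ne_top : messageBits F m ≠ ⊤ := ENNReal.ofReal_ne_top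

/-- The common source of both upper bounds. Allowing `r = D` lets the case `p = 0` reach up to `K =
2D`. -/
theorem linearCapacity_le (hDK : D ≤ K) (hm : 1 ≤ m) (hN : N ≠ 0) (hD : 0 < D) {p r : ℕ}
    (hr : r ≤ D) (hK : (p + 1) * D + r = K) :
    linearCapacity F m N hDK ≤ ENNReal.ofReal
      (∑ i ∈ Finset.range (p + 1), (1 / (N : ℝ)) ^ i + r / D * (1 / (N : ℝ)) ^ (p + 1))⁻¹ := by
  refine iSup_le fun P => iSup₂_le fun hp h => ?_
  obtain ⟨W⟩ := demand_nonempty hDK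
  set t : ℝ := ∑ i ∈ Finset.range (p + 1), (1 / (N : ℝ)) ^ i + r / D * (1 / (N : ℝ)) ^ (p + 1)
  have ht : 0 < t := by
    have : 0 < ∑ i ∈ Finset.range (p + 1), (1 / (N : ℝ)) ^ i :=
      Finset.sum_pos (fun i _ => by positivity) ⟨0, by simp⟩
    positivity
  have hB := (messageBits_pos (F := F) hm).ne'
  have hd : (D * messageBits F m) * ENNReal.ofReal t ≤ ⨆ W, expectedDownload m P W := by
    refine le_trans ?_ (le_iSup _ W)
    rw [expectedDownload_eq]
    have := le_queryMean_length hm hp h hr hK W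
    calc _ = (D * ENNReal.ofReal t) * messageBits F m := by ring
      _ ≤ _ := by
        gcongr
        refine le_trans (le_of_eq ?_) this
        have hNi : (N : ℝ≥0∞)⁻¹ = ENNReal.ofReal (1 / N) := by
          rw [one_div, ENNReal.ofReal_inv_of_pos (by positivity), ENNReal.ofReal_natCast]
        rw [hNi, ← ENNReal.ofReal_natCast D, ← ENNReal.ofReal_natCast r]
        simp_rw [← ENNReal.ofReal_pow (show (0 : ℝ) ≤ 1 / N by positivity)]
        rw [← ENNReal.ofReal_mul (by positivity), ← Finset.mul_sum,
          ← ENNReal.ofReal_sum_of_nonneg (fun i _ => by positivity),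
          ← ENNReal.ofReal_mul (by positivity), ← ENNReal.ofReal_mul (by positivity),
          ← ENNReal.ofReal_add (mul_nonneg (by positivity)
            (Finset.sum_nonneg fun i _ => by positivity)) (by positivity)]
        congr 1
        simp only [t]
        field_simp
  have hDB0 : D * messageBits F m ≠ 0 := mul_ne_zero (by exact_mod_cast hD.ne') hB
  have hDBt : D * messageBits F m ≠ ⊤ :=
    ENNReal.mul_ne_top (ENNReal.natCast_ne_top _) messageBits_ne_top
  calc rate m P ≤ D * messageBits F m / ((D * messageBits F m) * ENNReal.ofReal t) :=
        ENNReal.div_le_div_left hd _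
    _ = ENNReal.ofReal t⁻¹ := by
      rw [ENNReal.ofReal_inv_of_pos ht, ENNReal.div_eq_inv_mul,
        ENNReal.mul_inv (Or.inl hDB0) (Or.inl hDBt), mul_right_comm,
        ENNReal.inv_mul_cancel hDB0 hDBt, one_mul]

theorem linearCapacity_le_of_half_le (hDK : D ≤ K) (hm : 1 ≤ m) (hN : N ≠ 0) (hD : 0 < D)
    (h : (K : ℝ) / 2 ≤ D) :
    linearCapacity F m N hDK ≤ ENNReal.ofReal ((1 + ((K : ℝ) - D) / (D * N))⁻¹) := by
  have hK : K ≤ 2 * D := by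
    have : (K : ℝ) ≤ 2 * D := by linarith
    exact_mod_cast this
  have := linearCapacity_le (F := F) hDK hm hN hD (p := 0) (r := K - D) (by omega) (by omega)
  convert this using 3
  rw [Nat.cast_sub hDK]
  simp
  field_simp

theorem linearCapacity_le_of_le_half (hDK : D ≤ K) (hm : 1 ≤ m) (hN : 1 < N) (hD : 0 < D) :
    linearCapacity F m N hDK ≤
      ENNReal.ofReal
        (((1 - 1 / (N : ℝ) ^ ⌊(K : ℝ) / D⌋₊) / (1 - 1 / (N : ℝ)) +
          ((K : ℝ) / D - ⌊(K : ℝ) / D⌋₊) * (1 / (N : ℝ) ^ ⌊(K : ℝ) / D⌋₊))⁻¹) := by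
  rw [Nat.floor_div_eq_div]
  obtain ⟨p, hp⟩ : ∃ p, K / D = p + 1 :=
    ⟨K / D - 1, by have := Nat.div_pos hDK hD; omega⟩
  -- Division with remainder: `p + 1` is the integer part of `K / D`, and `r` is the remainder.
  have hK : (p + 1) * D + K % D = K := by
    rw [← hp, mul_comm]
    exact Nat.div_add_mod K D
  have := linearCapacity_le (F := F) (N := N) hDK hm (by omega) hD (Nat.mod_lt K hD).le hK
  convert this using 3
  have hN1 : (1 : ℝ) / N ≠ 1 := by
    rw [Ne, div_eq_one_iff_eq (by positivity)]
    exact_mod_cast hN.ne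
  rw [geom_sum_eq hN1, hp, ← neg_sub, ← neg_sub (1 / (N : ℝ)) 1, neg_div_neg_eq, one_div_pow]
  congr 2
  have : (K : ℝ) = (p + 1) * D + (K % D : ℕ) := by exact_mod_cast hK.symm
  push_cast
  field_simp
  linarith

/-! ### Vectors with a given support -/

open Classical in
/-- The support of a vector. -/
def vsupport {F ι : Type*} [Zero F] [Fintype ι] (v : ι → F) : Finset ι :=
  Finset.univ.filter fun k => v k ≠ 0

theorem mem_vsupport {F ι : Type*} [Zero F] [Fintype ι] {v : ι → F} {k : ι} :
    k ∈ vsupport v ↔ v k ≠ 0 := by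
  simp [vsupport]

/-- The vectors of weight `j` span the space, so a basis can be chosen among them. Two such vectors
with the same support that differ only at `k`, with values `1` and `x ∉ {0, 1}`, have a multiple of
`e_k` as difference; such an `x` needs `q ≥ 3`. -/
theorem exists_basis_card_vsupport {F : Type*} [Field F] [Fintype F] (hF : 2 < Fintype.card F)
    {D j : ℕ} (hj : 1 ≤ j) (hjD : j ≤ D) :
    ∃ a : Fin D → Fin D → F, LinearIndependent F a ∧ ∀ t, (vsupport (a t)).card = j := by
  classical
  set s : Set (Fin D → F) := {v | (vsupport v).card = j}
  obtain ⟨x, hx0, hx1⟩ : ∃ x : F, x ≠ 0 ∧ x ≠ 1 := by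
    by_contra! h
    have : (Finset.univ : Finset F) ⊆ {0, 1} := fun x _ => by
      by_cases hx : x = 0
      · simp [hx]
      · simp [h x hx]
    have := (Finset.card_le_card this).trans Finset.card_le_two
    rw [Finset.card_univ] at this
    omega
  have hs : ⊤ ≤ Submodule.span F s := by
    rw [← (Pi.basisFun F (Fin D)).span_eq, Submodule.span_le]
    rintro _ ⟨k, rfl⟩
    obtain ⟨S, hkS, -, hS⟩ := Finset.exists_subsuperset_card_eq (Finset.subset_univ {k})
      (by simpa using hj) (by simpa using hjD)
    have hk : k ∈ S := hkS (Finset.mem_singleton_self k)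
    have hv (y : F) (hy : y ≠ 0) : (fun i => if i = k then y else if i ∈ S then 1 else 0) ∈ s := by
      change (vsupport _).card = j
      rw [← hS]
      congr 1
      ext i
      rw [mem_vsupport]
      by_cases hi : i = k
      · simp [hi, hy, hk]
      · simp [hi]
    have he : (Pi.basisFun F (Fin D)) k =
        (x - 1)⁻¹ • ((fun i => if i = k then x else if i ∈ S then 1 else 0) -
          fun i => if i = k then 1 else if i ∈ S then 1 else 0) := by
      ext i
      have := sub_ne_zero.2 hx1
      by_cases hi : i = k
      · simp [hi, this]
      · simp [hi]
    rw [he]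
    exact Submodule.smul_mem _ _ (Submodule.sub_mem _ (Submodule.subset_span (hv x hx0))
      (Submodule.subset_span (hv 1 one_ne_zero)))
  let b := Module.Basis.ofSpan hs
  have : Fintype ((linearIndepOn_empty F id).extend (Set.empty_subset s)) :=
    FiniteDimensional.fintypeBasisIndex b
  have hcard := Module.finrank_eq_card_basis b
  rw [Module.finrank_fin_fun] at hcard
  let b' := b.reindex (Fintype.equivFinOfCardEq hcard.symm)
  refine ⟨b', b'.linearIndependent, fun t => ?_⟩
  have : b' t ∈ s := by
    rw [Module.Basis.reindex_apply]
    exact Module.Basis.ofSpan_subset hs (Set.mem_range_self _)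
  exact this

/-! ### Counting -/

open Classical in
-- The nonzero entries of `u` can be absorbed into the scaling, so the count depends on `u` only
-- through its support.
theorem sum_scale_eq {F ι : Type*} [Field F] [Fintype F] [Fintype ι] [DecidableEq ι] (u v : ι → F) :
    ∑ d : ι → Fˣ, (if (fun k => (d k : F) * u k) = v then (1 : ℝ) else 0) =
      if vsupport u = vsupport v then
        ∑ d : ι → Fˣ, if (fun k => (d k : F) * if k ∈ vsupport v then 1 else 0) = v
          then (1 : ℝ) else 0
      else 0 := by
  split_ifs with h
  · let e : ι → Fˣ := fun k => if hk : u k = 0 then 1 else Units.mk0 (u k) hk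
    refine Fintype.sum_equiv (Equiv.mulRight e) _ _ fun d => ?_
    congr 2
    ext k
    have hk : k ∈ vsupport v ↔ u k ≠ 0 := by rw [← h, mem_vsupport]
    by_cases huk : u k = 0 <;> simp [e, huk, hk]
  · refine Finset.sum_eq_zero fun d _ => if_neg fun hd => h ?_
    ext k
    rw [mem_vsupport, mem_vsupport, ← hd]
    simp

/-- Permutations of `β` act transitively on subsets of a given size, so every target of size `|A|`
is hit equally often, and all bijections are shared evenly. -/
theorem sum_equiv_map_eq {α β : Type*} [Fintype α] [Fintype β] [DecidableEq α] [DecidableEq β] (e : α ≃ β) (A : Finset α)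
    (S : Finset β) :
    ∑ σ : α ≃ β, (if A.map σ.toEmbedding = S then (1 : ℝ) else 0) =
      if A.card = S.card then
        (Fintype.card α).factorial / ((Fintype.card α).choose A.card : ℝ)
      else 0 := by
  split_ifs with h
  · have hS (S' : Finset β) (hS' : S'.card = A.card) :
        ∑ σ : α ≃ β, (if A.map σ.toEmbedding = S' then (1 : ℝ) else 0) =
          ∑ σ : α ≃ β, (if A.map σ.toEmbedding = S then (1 : ℝ) else 0) := by
      let f : {x // x ∈ S'} ≃ {x // x ∈ S} := Finset.equivOfCardEq (hS'.trans h)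
      let ρ : Equiv.Perm β := f.extendSubtype
      have hρ : S'.map ρ.toEmbedding = S := by
        refine Finset.eq_of_subset_of_card_le (fun x hx => ?_) (by simp [hS', h])
        obtain ⟨y, hy, rfl⟩ := Finset.mem_map.1 hx
        exact f.extendSubtype_mem y hy
      refine Fintype.sum_equiv ((Equiv.refl α).equivCongr ρ) _ _ fun σ => ?_
      congr 1
      rw [← hρ]
      have : A.map ((Equiv.refl α).equivCongr ρ σ).toEmbedding =
          (A.map σ.toEmbedding).map ρ.toEmbedding := by
        rw [Finset.map_map]
        rfl
      rw [this, (Finset.map_injective _).eq_iff]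
    have hA : A.card ≤ Fintype.card α := Finset.card_le_univ A
    have hc : ((Fintype.card α).choose A.card : ℝ) ≠ 0 := by
      exact_mod_cast (Nat.choose_pos hA).ne'
    rw [eq_div_iff hc]
    calc _ = ∑ S' ∈ Finset.univ.powersetCard A.card,
          ∑ σ : α ≃ β, (if A.map σ.toEmbedding = S' then (1 : ℝ) else 0) := by
          rw [Finset.sum_congr rfl fun S' hS' => hS S' (Finset.mem_powersetCard.1 hS').2,
            Finset.sum_const, Finset.card_powersetCard, Finset.card_univ, Fintype.card_congr e,
            nsmul_eq_mul, mul_comm]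
      _ = ∑ σ : α ≃ β, (1 : ℝ) := by
          rw [Finset.sum_comm]
          refine Finset.sum_congr rfl fun σ _ => ?_
          rw [Finset.sum_ite_eq, if_pos]
          simp [Finset.mem_powersetCard]
      _ = _ := by
          rw [Finset.sum_const, Finset.card_univ, Fintype.card_equiv e, nsmul_eq_mul, mul_one]
  · refine Finset.sum_eq_zero fun σ _ => if_neg fun hσ => h ?_
    rw [← hσ, Finset.card_map]

/-! ### The weights of the protocol -/

section Weights

variable {D : ℕ}

theorem lcoef_pos (hD : 0 < D) {j : ℕ} (hj : j ≤ D) : 0 < lcoef D j := by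
  have : 0 < (D.choose j).lcm D := Nat.lcm_pos (Nat.choose_pos hj) hD
  rw [lcoef]
  positivity

theorem mcoef_pos (hD : 0 < D) {j : ℕ} (hj : j ≤ D) : 0 < mcoef D j := by
  have := lcoef_pos hD hj
  have : 0 < D.choose j := Nat.choose_pos hj
  rw [mcoef]
  positivity

theorem mcoef_one (hD : 0 < D) : mcoef D 1 = 1 := by
  have : (D : ℝ) ≠ 0 := by positivity
  simp [mcoef, lcoef, this]

theorem Mmat_nonneg (i j : Fin D) : 0 ≤ Mmat D i j := by
  have hl (k : ℕ) : 0 ≤ lcoef D k := by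
    rw [lcoef]
    positivity
  have hm (k : ℕ) : 0 ≤ mcoef D k := by
    have := hl k
    rw [mcoef]
    positivity
  simp only [Mmat, Matrix.of_apply]
  split_ifs
  exacts [hl _, div_nonneg (hm _) (hm _), le_rfl]

theorem Mmat_pow_nonneg (n : ℕ) (i j : Fin D) : 0 ≤ (Mmat D ^ n) i j := by
  induction n generalizing j with
  | zero =>
    rw [pow_zero, Matrix.one_apply]
    split_ifs <;> norm_num
  | succ n ih =>
    rw [pow_succ, Matrix.mul_apply]
    exact Finset.sum_nonneg fun k _ => mul_nonneg (ih k) (Mmat_nonneg k j)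

/-- `∑_j l_j (M^e)_{j,j₀}`. -/
def columnWeight (j₀ : Fin D) (e : ℕ) : ℝ :=
  ∑ j, Lvec D j * (Mmat D ^ e) j j₀

theorem columnWeight_nonneg (hD : 0 < D) (j₀ : Fin D) (e : ℕ) : 0 ≤ columnWeight j₀ e :=
  Finset.sum_nonneg fun j _ => mul_nonneg (lcoef_pos hD j.2).le (Mmat_pow_nonneg _ _ _)

theorem Fvec_eq (K : ℕ) (j₀ : Fin D) : Fvec K D j₀ = columnWeight j₀ (K - D) := rfl

/-- The binomial coefficient counts the interference supports of size `i` outside the demand, which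
makes `Gvec` the normalizing constant of the protocol's weights. -/
theorem Gvec_eq (K : ℕ) (j₀ : Fin D) :
    Gvec K D j₀ = ∑ i ∈ Finset.range (K - D + 1),
      ((K - D).choose i : ℝ) * columnWeight j₀ (K - D - i) := by
  have h : (1 + Mmat D) ^ (K - D) = ∑ i ∈ Finset.range (K - D + 1),
      ((K - D).choose i : ℝ) • Mmat D ^ (K - D - i) := by
    rw [(Commute.one_left (Mmat D)).add_pow]
    refine Finset.sum_congr rfl fun i _ => ?_
    rw [one_pow, one_mul, ← Nat.cast_comm, ← nsmul_eq_mul, Nat.cast_smul_eq_nsmul]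
  rw [Gvec, h, Matrix.vecMul_sum, Finset.sum_apply]
  refine Finset.sum_congr rfl fun i _ => ?_
  rw [Matrix.vecMul_smul, Pi.smul_apply, smul_eq_mul]
  rfl

theorem Gvec_pos (hD : 0 < D) (K : ℕ) (j₀ : Fin D) : 0 < Gvec K D j₀ := by
  rw [Gvec_eq]
  refine Finset.sum_pos' (fun i _ => mul_nonneg (Nat.cast_nonneg _) (columnWeight_nonneg hD _ _))
    ⟨K - D, by simp, ?_⟩
  simpa [columnWeight, Matrix.one_apply, Lvec] using lcoef_pos hD j₀.2

theorem Fvec_le_Gvec (hD : 0 < D) (K : ℕ) (j₀ : Fin D) : Fvec K D j₀ ≤ Gvec K D j₀ := by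
  rw [Gvec_eq, Fvec_eq]
  have := Finset.single_le_sum (s := Finset.range (K - D + 1)) (a := 0)
    (f := fun i => ((K - D).choose i : ℝ) * columnWeight j₀ (K - D - i))
    (fun i _ => mul_nonneg (Nat.cast_nonneg _) (columnWeight_nonneg hD _ _)) (by simp)
  simpa using this

/-- The weight of a support of which `s` elements lie inside and the others outside the demand,
in terms of the exponent `e` of the matrix. -/
def supportWeight (j₀ : Fin D) (e s : ℕ) : ℝ :=
  columnWeight j₀ e * (if s = 0 then 1 else 0) +
    ∑ j : Fin D, if (j : ℕ) + 1 = s then mcoef D s * (Mmat D ^ e) j j₀ else 0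

theorem supportWeight_zero (j₀ : Fin D) (e : ℕ) : supportWeight j₀ e 0 = columnWeight j₀ e := by
  simp [supportWeight]

theorem supportWeight_succ (j₀ : Fin D) (e : ℕ) {s : ℕ} (hs : s < D) :
    supportWeight j₀ e (s + 1) = mcoef D (s + 1) * (Mmat D ^ e) ⟨s, hs⟩ j₀ := by
  rw [supportWeight, Finset.sum_eq_single ⟨s, hs⟩]
  · simp
  · intro j _ hj
    refine if_neg fun h => hj (Fin.ext ?_)
    simpa using h
  · simp

/-- The reason for the shape of `M`: its first row gives the step from `s = 0` to `1`, since `m_1 =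
1`, and the subdiagonal ratio `m_s / m_{s+1}` gives the step from `s` to `s + 1` for `s ≥ 1`. -/
theorem supportWeight_step (hD : 0 < D) (j₀ : Fin D) (e : ℕ) {s : ℕ} (hs : s < D) :
    supportWeight j₀ (e + 1) (s + 1) = supportWeight j₀ e s := by
  rw [supportWeight_succ j₀ _ hs, pow_succ', Matrix.mul_apply]
  cases s with
  | zero =>
    rw [supportWeight_zero, zero_add, mcoef_one hD, one_mul]
    simp [Mmat, columnWeight, Lvec]
  | succ s =>
    have hs' : s < D := by omega
    rw [supportWeight_succ j₀ _ hs', Finset.sum_eq_single ⟨s, hs'⟩]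
    · have := (mcoef_pos hD (j := s + 2) (by omega)).ne'
      simp only [Mmat, Matrix.of_apply]
      simp
      field_simp
    · intro j _ hj
      have : ¬ s = j := fun h => hj (Fin.ext h.symm)
      simp [Mmat, this]
    · simp

theorem supportWeight_add (hD : 0 < D) (j₀ : Fin D) (e s t : ℕ) (h : s + t ≤ D) :
    supportWeight j₀ (e + t) (s + t) = supportWeight j₀ e s := by
  induction t with
  | zero => rfl
  | succ t ih =>
    rw [← add_assoc, ← add_assoc, supportWeight_step hD j₀ _ (by omega), ih (by omega)]

/-- The weight depends only on `e - s`; the hypothesis states equality of these differences without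
subtraction. -/
theorem supportWeight_eq (hD : 0 < D) (j₀ : Fin D) {e s e' s' : ℕ} (h : e + s' = e' + s)
    (hs : s ≤ D) (hs' : s' ≤ D) : supportWeight j₀ e s = supportWeight j₀ e' s' := by
  rcases le_total s s' with hle | hle
  · obtain ⟨t, rfl⟩ := Nat.exists_eq_add_of_le hle
    obtain rfl : e' = e + t := by omega
    exact (supportWeight_add hD j₀ e s t hs').symm
  · obtain ⟨t, rfl⟩ := Nat.exists_eq_add_of_le hle
    obtain rfl : e = e' + t := by omega
    exact supportWeight_add hD j₀ e' s' t hs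

end Weights

/-! ### Laws with real weights -/

/-- The law on a finite type with the given real weights. -/
def weightLaw {Ω : Type*} [Fintype Ω] (w : Ω → ℝ) (h0 : ∀ ω, 0 ≤ w ω) (h1 : ∑ ω, w ω = 1) :
    PMF Ω :=
  PMF.ofFintype (fun ω => ENNReal.ofReal (w ω)) (by
    rw [← ENNReal.ofReal_sum_of_nonneg fun ω _ => h0 ω, h1, ENNReal.ofReal_one])

open Classical in
theorem prob_map_weightLaw {Ω β : Type*} [Fintype Ω] {w : Ω → ℝ} (h0 : ∀ ω, 0 ≤ w ω)
    (h1 : ∑ ω, w ω = 1) (f : Ω → β) (A : Set β) :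
    prob ((weightLaw w h0 h1).map f) A =
      ENNReal.ofReal (∑ ω, w ω * if f ω ∈ A then 1 else 0) := by
  rw [prob, PMF.toOuterMeasure_map_apply, PMF.toOuterMeasure_apply_fintype,
    ENNReal.ofReal_sum_of_nonneg fun ω _ => mul_nonneg (h0 ω) (by split_ifs <;> norm_num)]
  refine Finset.sum_congr rfl fun ω _ => ?_
  by_cases h : f ω ∈ A <;> simp [h, weightLaw]

theorem tsum_map_weightLaw {Ω β : Type*} [Fintype Ω] {w : Ω → ℝ} (h0 : ∀ ω, 0 ≤ w ω)
    (h1 : ∑ ω, w ω = 1) (f : Ω → β) (g : β → ℝ≥0∞) (g' : Ω → ℝ) (hg0 : ∀ ω, 0 ≤ g' ω)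
    (hg : ∀ ω, g (f ω) = ENNReal.ofReal (g' ω)) :
    ∑' b, (weightLaw w h0 h1).map f b * g b = ENNReal.ofReal (∑ ω, w ω * g' ω) := by
  have h (b : β) : (weightLaw w h0 h1).map f b = prob (weightLaw w h0 h1) {ω | f ω = b} := by
    rw [← PMF.toOuterMeasure_apply_singleton, PMF.toOuterMeasure_map_apply]
    rfl
  simp_rw [h]
  rw [← tsum_mul_comp, tsum_fintype,
    ENNReal.ofReal_sum_of_nonneg fun ω _ => mul_nonneg (h0 ω) (hg0 ω)]
  refine Finset.sum_congr rfl fun ω _ => ?_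
  rw [hg, ENNReal.ofReal_mul (h0 ω)]
  rfl

/-! ### The protocol -/

/-- The query which asks for the combination with coefficients `v`, or for nothing if `v = 0`. -/
def toQuery (v : Fin K → F) : Query F K :=
  open Classical in if v = 0 then [] else [v]

/-- This reduces the law of a query to that of its coefficient vector. -/
theorem toQuery_injective : Function.Injective (toQuery (F := F) (K := K)) := by
  intro v w h
  unfold toQuery at h
  split_ifs at h with h1 h2 h2
  · rw [h1, h2]
  · simpa using h

theorem sum_mul_eq_zero_of_answer_eq {m : ℕ} {v : Fin K → F} {X X' : Messages F m K}
    (h : answer (toQuery v) X = answer (toQuery v) X') (i : Fin m) :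
    ∑ k, v k * (X k i - X' k i) = 0 := by
  unfold toQuery at h
  split_ifs at h with h0
  · simp [h0]
  · have := congrFun (List.singleton_injective h) i
    simp only [Finset.sum_apply, Pi.smul_apply, smul_eq_mul] at this
    simp_rw [mul_sub]
    rw [Finset.sum_sub_distrib, this, sub_self]

/-- The vector with the coefficients `b` inside the demand and the interference supported on `I`
outside of it. -/
def blockVec (W : Demand K D) (I : Finset (Fin K)) (σ : Fin D ≃ W.1) (b : Fin D → F) :
    Fin K → F :=
  fun k => if h : k ∈ W.1 then b (σ.symm ⟨k, h⟩) else if k ∈ I then 1 else 0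

/-- A prescribed support forces the interference to be `S \ W` and leaves a condition on the
placement alone. -/
theorem vsupport_blockVec (W : Demand K D) {I : Finset (Fin K)} (hI : Disjoint I W.1)
    (σ : Fin D ≃ W.1) (b : Fin D → F) (S : Finset (Fin K)) :
    vsupport (blockVec W I σ b) = S ↔
      I = S \ W.1 ∧ (vsupport b).map σ.toEmbedding = S.subtype (· ∈ W.1) := by
  have hmem (k : Fin K) : k ∈ vsupport (blockVec W I σ b) ↔
      (∃ h : k ∈ W.1, (⟨k, h⟩ : W.1) ∈ (vsupport b).map σ.toEmbedding) ∨ k ∈ I := by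
    rw [mem_vsupport, blockVec]
    by_cases h : k ∈ W.1
    · have hkI : k ∉ I := fun hk => Finset.disjoint_left.1 hI hk h
      simp [h, hkI, Finset.mem_map_equiv, mem_vsupport]
    · simp [h]
  constructor
  · rintro rfl
    constructor
    · ext k
      rw [Finset.mem_sdiff, hmem]
      refine ⟨fun hk => ⟨Or.inr hk, Finset.disjoint_left.1 hI hk⟩, ?_⟩
      rintro ⟨⟨h, -⟩ | hk, hW⟩
      exacts [absurd h hW, hk]
    · ext ⟨k, hk⟩
      rw [Finset.mem_subtype, hmem]
      refine ⟨fun h => Or.inl ⟨hk, h⟩, ?_⟩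
      rintro (⟨_, h⟩ | h)
      exacts [h, absurd hk (Finset.disjoint_left.1 hI h)]
  · rintro ⟨hI', hb⟩
    ext k
    rw [hmem, hb, hI']
    simp only [Finset.mem_subtype, Finset.mem_sdiff]
    tauto

/-- The type of the coefficients inside the demand, the support of the interference, the
placement of the coefficients, the scaling, and the shift of the servers. -/
abbrev Sample (F : Type*) [Field F] {K D : ℕ} (W : Demand K D) : Type _ :=
  Fin D × Finset (Fin K) × (Fin D ≃ W.1) × (Fin K → Fˣ) × Fin (D + 1)

/-- The coefficient vector of a server. -/
def sampleVec (a : Fin D → Fin D → Fin D → F) (W : Demand K D) (ω : Sample F W) (n : Fin (D + 1)) :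
    Fin K → F :=
  fun k => (ω.2.2.2.1 k : F) *
    blockVec W ω.2.1 ω.2.2.1 (Fin.cons (α := fun _ => Fin D → F) 0 (a ω.1) (n + ω.2.2.2.2)) k

/-- The number of placements, scalings and shifts. -/
def sampleCount (F : Type*) [Field F] [Fintype F] (K D : ℕ) : ℝ :=
  open Classical in D.factorial * Fintype.card (Fin K → Fˣ) * (D + 1)

theorem sampleCount_pos : 0 < sampleCount F K D := by
  classical
  have : 0 < Fintype.card (Fin K → Fˣ) := Fintype.card_pos
  have := D.factorial_pos
  rw [sampleCount]
  positivity

/-- The weight of a coefficient family and a support of the interference. -/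
def familyWeight (j₀ : Fin D) (W : Demand K D) (j : Fin D) (I : Finset (Fin K)) : ℝ :=
  if Disjoint I W.1 then
    Lvec D j * (Mmat D ^ (K - D - I.card)) j j₀ / Gvec K D j₀
  else 0

/-- The probability of a sample. -/
def sampleWeight (j₀ : Fin D) (W : Demand K D) (ω : Sample F W) : ℝ :=
  familyWeight j₀ W ω.1 ω.2.1 / sampleCount F K D

theorem familyWeight_nonneg (j₀ : Fin D) (W : Demand K D) (j : Fin D) (I : Finset (Fin K)) :
    0 ≤ familyWeight j₀ W j I := by
  have hD : 0 < D := j₀.pos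
  rw [familyWeight]
  split_ifs
  · exact div_nonneg (mul_nonneg (lcoef_pos hD j.2).le (Mmat_pow_nonneg _ _ _))
      (Gvec_pos hD K j₀).le
  · rfl

theorem sampleWeight_nonneg (j₀ : Fin D) (W : Demand K D) (ω : Sample F W) :
    0 ≤ sampleWeight j₀ W ω :=
  div_nonneg (familyWeight_nonneg _ _ _ _) sampleCount_pos.le

theorem sum_familyWeight (j₀ : Fin D) (W : Demand K D) :
    ∑ j, ∑ I, familyWeight j₀ W j I = 1 := by
  have hD : 0 < D := j₀.pos
  have hG := (Gvec_pos hD K j₀).ne'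
  have hW : W.1ᶜ.card = K - D := by rw [Finset.card_compl, Fintype.card_fin, W.2]
  calc _ = ∑ I : Finset (Fin K), if Disjoint I W.1 then
        columnWeight j₀ (K - D - I.card) / Gvec K D j₀ else 0 := by
        rw [Finset.sum_comm]
        refine Finset.sum_congr rfl fun I _ => ?_
        simp only [familyWeight]
        split_ifs
        · rw [← Finset.sum_div]
          rfl
        · simp
    _ = ∑ I ∈ W.1ᶜ.powerset, columnWeight j₀ (K - D - I.card) / Gvec K D j₀ := by
        rw [← Finset.sum_filter]
        congr 1
        ext I
        simp [Finset.subset_compl_iff_disjoint_right]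
    _ = 1 := by
        rw [← Finset.sum_div, Finset.sum_powerset_apply_card
          (fun i => columnWeight j₀ (K - D - i)), hW, div_eq_one_iff_eq hG, Gvec_eq]
        simp

theorem card_placement (W : Demand K D) : Fintype.card (Fin D ≃ W.1) = D.factorial := by
  have e : Fin D ≃ W.1 := (Fintype.equivFinOfCardEq (by rw [Fintype.card_coe, W.2])).symm
  rw [Fintype.card_equiv e, Fintype.card_fin]

open Classical in
theorem sum_sampleWeight (j₀ : Fin D) (W : Demand K D) :
    ∑ ω : Sample F W, sampleWeight j₀ W ω = 1 := by
  have hZ := (sampleCount_pos (F := F) (K := K) (D := D)).ne'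
  simp only [sampleWeight, Fintype.sum_prod_type, Finset.sum_const, nsmul_eq_mul, Finset.card_univ,
    Fintype.card_prod, card_placement, Fintype.card_fin]
  simp only [← Finset.mul_sum, ← Finset.sum_div, sum_familyWeight]
  rw [sampleCount]
  push_cast
  rw [sampleCount] at hZ
  field_simp

open Classical in
-- Over the shifts a server sees the zero vector once, for every `j`, which gives the `columnWeight`
-- term. It sees each of the `D` vectors of weight `s = j + 1` once, and a placement matches a given
-- `s`-set with probability `1 / binom(D,s)`; this is the origin of `m_s = D l_s / binom(D,s)`.
theorem sum_placement_shift (j₀ : Fin D) {a : Fin D → Fin D → Fin D → F}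
    (ha : ∀ j t, (vsupport (a j t)).card = j + 1) (W : Demand K D) (n : Fin (D + 1)) (e : ℕ)
    (S : Finset W.1) :
    ∑ j, Lvec D j * (Mmat D ^ e) j j₀ * ∑ σ : Fin D ≃ W.1, ∑ τ : Fin (D + 1),
      (if (vsupport (Fin.cons (α := fun _ => Fin D → F) 0 (a j) (n + τ) : Fin D → F)).map
        σ.toEmbedding = S then (1 : ℝ) else 0) =
      D.factorial * supportWeight j₀ e S.card := by
  have hD : 0 < D := j₀.pos
  have e0 : Fin D ≃ W.1 := (Fintype.equivFinOfCardEq (by rw [Fintype.card_coe, W.2])).symm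
  have h0 : (vsupport (0 : Fin D → F)).card = 0 := by simp [vsupport]
  have h (j : Fin D) : ∑ σ : Fin D ≃ W.1, ∑ τ : Fin (D + 1),
      (if (vsupport (Fin.cons (α := fun _ => Fin D → F) 0 (a j) (n + τ) : Fin D → F)).map
        σ.toEmbedding = S then (1 : ℝ) else 0) =
      D.factorial * ((if S.card = 0 then 1 else 0) +
        if (j : ℕ) + 1 = S.card then D / (D.choose S.card : ℝ) else 0) := by
    rw [Finset.sum_comm]
    -- As `τ` varies, `n + τ` runs once through all positions, so the result does not depend on the
    -- server.
    refine (Equiv.sum_comp (Equiv.addLeft n) (fun x => ∑ σ : Fin D ≃ W.1,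
      (if (vsupport (Fin.cons (α := fun _ => Fin D → F) 0 (a j) x : Fin D → F)).map
        σ.toEmbedding = S then (1 : ℝ) else 0))).trans ?_
    rw [Fin.sum_univ_succ]
    simp only [Fin.cons_zero, Fin.cons_succ, sum_equiv_map_eq e0, h0, ha, Fintype.card_fin,
      Finset.sum_const, Finset.card_univ, nsmul_eq_mul]
    rw [mul_add]
    congr 1
    · by_cases hS : S.card = 0
      · simp [hS]
      · simp [hS, Ne.symm hS]
    · split_ifs with hj
      · rw [hj]
        ring
      · simp
  simp_rw [h]
  rw [supportWeight, columnWeight, Finset.sum_mul, ← Finset.sum_add_distrib, Finset.mul_sum]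
  refine Finset.sum_congr rfl fun j _ => ?_
  by_cases hj : (j : ℕ) + 1 = S.card
  · rw [if_pos hj, if_pos hj, mcoef, Lvec, hj]
    ring
  · rw [if_neg hj, if_neg hj]
    ring

open Classical in
/-- The number of scalings which turn the indicator vector of the support of `v` into `v`. -/
def scaleCount (v : Fin K → F) : ℝ :=
  ∑ d : Fin K → Fˣ, if (fun k => (d k : F) * if k ∈ vsupport v then 1 else 0) = v then 1 else 0

open Classical in
theorem sum_scale_sampleVec_eq (a : Fin D → Fin D → Fin D → F) (W : Demand K D) (n : Fin (D + 1))
    (v : Fin K → F) (j : Fin D) (I : Finset (Fin K)) (σ : Fin D ≃ W.1) (τ : Fin (D + 1)) :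
    ∑ d : Fin K → Fˣ, (if sampleVec a W (j, I, σ, d, τ) n = v then (1 : ℝ) else 0) =
      if vsupport (blockVec W I σ (Fin.cons (α := fun _ => Fin D → F) 0 (a j) (n + τ))) =
        vsupport v then scaleCount v else 0 :=
  sum_scale_eq (blockVec W I σ (Fin.cons (α := fun _ => Fin D → F) 0 (a j) (n + τ))) v

open Classical in
-- With `S` the support of `v`, the arguments of `supportWeight` are `e = K - |S ∪ W|` and `s = |S ∩
-- W|`. No other factor involves `W`.
theorem sum_sampleWeight_sampleVec_eq (j₀ : Fin D) {a : Fin D → Fin D → Fin D → F}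
    (ha : ∀ j t, (vsupport (a j t)).card = j + 1) (W : Demand K D) (n : Fin (D + 1))
    (v : Fin K → F) :
    ∑ ω : Sample F W, sampleWeight j₀ W ω * (if sampleVec a W ω n = v then 1 else 0) =
      scaleCount v / sampleCount F K D / Gvec K D j₀ * D.factorial *
        supportWeight j₀ (K - (vsupport v ∪ W.1).card)
          ((vsupport v).card - (vsupport v \ W.1).card) := by
  have hcard1 : K - D - (vsupport v \ W.1).card = K - (vsupport v ∪ W.1).card := by
    rw [← Finset.card_sdiff_add_card, W.2]
    omega
  have hcard2 : ((vsupport v).subtype (· ∈ W.1)).card =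
      (vsupport v).card - (vsupport v \ W.1).card := by
    have := Finset.card_filter_add_card_filter_not (s := vsupport v) (· ∈ W.1)
    rw [Finset.card_subtype, Finset.sdiff_eq_filter]
    omega
  rw [← hcard1, ← hcard2, mul_assoc, ← sum_placement_shift j₀ ha W n, Finset.mul_sum,
    Fintype.sum_prod_type]
  refine Finset.sum_congr rfl fun j _ => ?_
  rw [Fintype.sum_prod_type, Finset.sum_eq_single (vsupport v \ W.1)]
  · have hw : familyWeight j₀ W j (vsupport v \ W.1) =
        Lvec D j * (Mmat D ^ (K - D - (vsupport v \ W.1).card)) j j₀ / Gvec K D j₀ :=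
      if_pos Finset.sdiff_disjoint
    simp only [Fintype.sum_prod_type, sampleWeight, ← Finset.mul_sum]
    have hd (σ : Fin D ≃ W.1) : ∑ d : Fin K → Fˣ, ∑ τ : Fin (D + 1),
        (if sampleVec a W (j, vsupport v \ W.1, σ, d, τ) n = v then (1 : ℝ) else 0) =
        scaleCount v * ∑ τ : Fin (D + 1),
          if (vsupport (Fin.cons (α := fun _ => Fin D → F) 0 (a j) (n + τ) : Fin D → F)).map
            σ.toEmbedding = (vsupport v).subtype (· ∈ W.1) then 1 else 0 := by
      rw [Finset.sum_comm, Finset.mul_sum]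
      refine Finset.sum_congr rfl fun τ _ => ?_
      rw [sum_scale_sampleVec_eq]
      simp only [vsupport_blockVec W Finset.sdiff_disjoint, true_and, mul_ite, mul_one, mul_zero]
    rw [Finset.sum_congr rfl fun σ _ => hd σ, ← Finset.mul_sum, hw]
    ring
  · intro I _ hI
    rw [Fintype.sum_prod_type]
    refine Finset.sum_eq_zero fun σ _ => ?_
    by_cases hW : Disjoint I W.1
    · rw [Fintype.sum_prod_type, Finset.sum_comm]
      refine Finset.sum_eq_zero fun τ _ => ?_
      simp only [sampleWeight, ← Finset.mul_sum]
      rw [sum_scale_sampleVec_eq, if_neg, mul_zero]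
      rw [vsupport_blockVec W hW]
      exact fun h => hI h.1
    · simp [sampleWeight, familyWeight, hW]
  · simp

open Classical in
-- Privacy: `e - s = K - D - |S|` is the same for all demands, by inclusion-exclusion.
theorem sum_sampleWeight_sampleVec_congr (j₀ : Fin D) {a : Fin D → Fin D → Fin D → F}
    (ha : ∀ j t, (vsupport (a j t)).card = j + 1) (W W' : Demand K D) (n : Fin (D + 1))
    (v : Fin K → F) :
    ∑ ω : Sample F W, sampleWeight j₀ W ω * (if sampleVec a W ω n = v then 1 else 0) =
      ∑ ω : Sample F W', sampleWeight j₀ W' ω * (if sampleVec a W' ω n = v then 1 else 0) := by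
  rw [sum_sampleWeight_sampleVec_eq j₀ ha, sum_sampleWeight_sampleVec_eq j₀ ha]
  congr 1
  have h1 (V : Demand K D) : (vsupport v \ V.1).card + D = (vsupport v ∪ V.1).card := by
    rw [← Finset.card_sdiff_add_card, V.2]
  have h2 (V : Demand K D) : (vsupport v ∪ V.1).card ≤ K := by
    simpa using Finset.card_le_univ (vsupport v ∪ V.1)
  have h3 (V : Demand K D) : (vsupport v).card ≤ (vsupport v ∪ V.1).card :=
    Finset.card_le_card Finset.subset_union_left
  have h4 (V : Demand K D) : (vsupport v \ V.1).card ≤ (vsupport v).card :=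
    Finset.card_le_card Finset.sdiff_subset
  have := h1 W
  have := h1 W'
  have := h2 W
  have := h2 W'
  have := h3 W
  have := h3 W'
  have := h4 W
  have := h4 W'
  exact supportWeight_eq j₀.pos j₀ (by omega) (by omega) (by omega)

open Classical in
theorem sum_sampleWeight_sampleVec_eq_zero (j₀ : Fin D) {a : Fin D → Fin D → Fin D → F}
    (ha : ∀ j t, (vsupport (a j t)).card = j + 1) (W : Demand K D) (n : Fin (D + 1)) :
    ∑ ω : Sample F W, sampleWeight j₀ W ω * (if sampleVec a W ω n = 0 then 1 else 0) =
      Fvec K D j₀ / Gvec K D j₀ / (D + 1) := by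
  have h0 : vsupport (0 : Fin K → F) = ∅ := by
    ext k
    simp [mem_vsupport]
  have hs : scaleCount (0 : Fin K → F) = Fintype.card (Fin K → Fˣ) := by
    rw [scaleCount, h0, Finset.sum_congr rfl fun d _ => if_pos (by ext k; simp)]
    simp
  have hc : (Fintype.card (Fin K → Fˣ) : ℝ) ≠ 0 := by exact_mod_cast Fintype.card_ne_zero
  have hf : (D.factorial : ℝ) ≠ 0 := by exact_mod_cast D.factorial_ne_zero
  rw [sum_sampleWeight_sampleVec_eq j₀ ha, hs, h0]
  simp only [Finset.empty_union, Finset.card_empty, zero_tsub, W.2, supportWeight_zero,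
    ← Fvec_eq, sampleCount]
  field_simp

open Classical in
/-- The protocol with the coefficient families `a`. -/
def protocol (j₀ : Fin D) (a : Fin D → Fin D → Fin D → F) : QueryRule F (D + 1) K D :=
  fun W => (weightLaw (sampleWeight j₀ W) (sampleWeight_nonneg j₀ W) (sum_sampleWeight j₀ W)).map
    fun ω n => toQuery (sampleVec a W ω n)

theorem protocol_isPrivate (m : ℕ) (hDK : D ≤ K) (j₀ : Fin D) {a : Fin D → Fin D → Fin D → F}
    (ha : ∀ j t, (vsupport (a j t)).card = j + 1) : IsPrivate m hDK (protocol j₀ a) := by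
  classical
  rw [isPrivate_iff]
  intro n q W W'
  rw [protocol, protocol, prob_map_weightLaw, prob_map_weightLaw]
  congr 1
  simp only [Set.mem_ofPred_eq]
  by_cases hq : ∃ v, toQuery v = q
  · obtain ⟨v, rfl⟩ := hq
    simp only [toQuery_injective.eq_iff]
    exact sum_sampleWeight_sampleVec_congr j₀ ha W W' n v
  · push Not at hq
    simp [hq]

theorem protocol_isRecoverable (m : ℕ) (j₀ : Fin D) {a : Fin D → Fin D → Fin D → F}
    (ha : ∀ j, LinearIndependent F (a j)) :
    IsRecoverable m (protocol (K := K) j₀ a) := by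
  classical
  rw [isRecoverable_iff]
  intro W Q hQ X X' hX k hk
  obtain ⟨⟨j, I, σ, d, τ⟩, -, rfl⟩ := (PMF.mem_support_map_iff _ _ _).1 hQ
  ext i
  have hvec (x : Fin (D + 1)) : ∑ k, (d k : F) * blockVec W I σ
      (Fin.cons (α := fun _ => Fin D → F) 0 (a j) x) k * (X k i - X' k i) = 0 := by
    -- After the shift, server `x - τ` holds the vector at position `x`.
    have := sum_mul_eq_zero_of_answer_eq (hX (x - τ)) i
    simpa [sampleVec] using this
  have hdiff (t : Fin D) :
      ∑ s, a j t s * ((d (σ s).1 : F) * (X (σ s).1 i - X' (σ s).1 i)) = 0 := by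
    -- Position `0` carries pure interference, so subtracting it leaves only coordinates in `W`.
    have := sub_eq_zero.2 ((hvec t.succ).trans (hvec 0).symm)
    rw [← Finset.sum_sub_distrib] at this
    rw [← this, ← Finset.sum_subset (Finset.subset_univ W.1)]
    · refine Eq.trans ?_ (Finset.sum_coe_sort W.1 _)
      refine Eq.trans ?_ (Equiv.sum_comp σ _)
      refine Finset.sum_congr rfl fun s _ => ?_
      simp [blockVec]
      ring
    · intro k _ hk
      simp [blockVec, hk]
  have hu : IsUnit (Matrix.of (a j)) := Matrix.linearIndependent_rows_iff_isUnit.1 (ha j)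
  have hz : (fun s => (d (σ s).1 : F) * (X (σ s).1 i - X' (σ s).1 i)) = 0 := by
    refine Matrix.mulVec_injective_of_isUnit hu ?_
    rw [Matrix.mulVec_zero]
    exact funext hdiff
  have := congrFun hz (σ.symm ⟨k, hk⟩)
  simpa [sub_eq_zero] using this

theorem expectedDownload_protocol (m : ℕ) (j₀ : Fin D) {a : Fin D → Fin D → Fin D → F}
    (ha : ∀ j t, (vsupport (a j t)).card = j + 1) (W : Demand K D) :
    expectedDownload m (protocol j₀ a) W =
      ENNReal.ofReal ((D + 1 : ℕ) - Fvec K D j₀ / Gvec K D j₀) * messageBits F m := by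
  classical
  rw [expectedDownload_eq, protocol, tsum_map_weightLaw _ _ _ _
    -- A server sends one combination unless its vector is `0`.
    (fun ω => ∑ n, (1 - if sampleVec a W ω n = 0 then (1 : ℝ) else 0))]
  · congr 2
    simp_rw [Finset.mul_sum]
    rw [Finset.sum_comm]
    simp_rw [mul_sub, mul_one, Finset.sum_sub_distrib, sum_sampleWeight,
      sum_sampleWeight_sampleVec_eq_zero j₀ ha]
    simp
    field_simp
  · exact fun ω => Finset.sum_nonneg fun n _ => by split_ifs <;> norm_num
  · intro ω
    rw [ENNReal.ofReal_sum_of_nonneg fun n _ => by split_ifs <;> norm_num]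
    refine Finset.sum_congr rfl fun n _ => ?_
    by_cases h : sampleVec a W ω n = 0 <;> simp [toQuery, h]

/-! ### The lower bound and the theorem -/

theorem le_linearCapacity (hF : 2 < Fintype.card F) {m : ℕ} (hm : 1 ≤ m) (hDK : D ≤ K)
    (j₀ : Fin D) :
    ENNReal.ofReal (D / ((D + 1 : ℕ) - Fvec K D j₀ / Gvec K D j₀)) ≤
      linearCapacity F m (D + 1) hDK := by
  choose a ha hac using fun j : Fin D =>
    exists_basis_card_vsupport hF (D := D) (j := j + 1) (by omega) (by omega)
  refine le_trans ?_ (le_iSup_of_le (protocol j₀ a) (le_iSup₂_of_le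
    (protocol_isPrivate m hDK j₀ hac) (protocol_isRecoverable m j₀ ha) le_rfl))
  have := demand_nonempty hDK
  have hG := Gvec_pos j₀.pos K j₀
  have hpos : 0 < ((D + 1 : ℕ) : ℝ) - Fvec K D j₀ / Gvec K D j₀ := by
    have h1 : Fvec K D j₀ / Gvec K D j₀ ≤ 1 := (div_le_one hG).2 (Fvec_le_Gvec j₀.pos K j₀)
    have h2 : (0 : ℝ) < D := by exact_mod_cast j₀.pos
    push_cast
    linarith
  simp only [rate, expectedDownload_protocol m j₀ hac, ciSup_const]
  rw [ENNReal.mul_div_mul_right _ _ (messageBits_pos hm).ne' messageBits_ne_top,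
    ENNReal.ofReal_div_of_pos hpos, ENNReal.ofReal_natCast]

end MPIR

end

theorem theorem1 {F : Type*} [Field F] [Fintype F] (m K D N : ℕ) (hm : 1 ≤ m) (hD : 1 < D)
    (hDK : D ≤ K) (hN : N = D + 1) :
    (2 < Fintype.card F →
      ENNReal.ofReal ((D : ℝ) / ((N : ℝ) - ⨆ j : Fin D, MPIR.Fvec K D j / MPIR.Gvec K D j)) ≤
        MPIR.linearCapacity F m N hDK) ∧
    ((K : ℝ) / 2 ≤ D →
      MPIR.linearCapacity F m N hDK ≤
        ENNReal.ofReal ((1 + ((K : ℝ) - D) / (D * N))⁻¹)) ∧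
    ((D : ℝ) ≤ (K : ℝ) / 2 →
      MPIR.linearCapacity F m N hDK ≤
        ENNReal.ofReal
          (((1 - 1 / (N : ℝ) ^ ⌊(K : ℝ) / D⌋₊) / (1 - 1 / (N : ℝ)) +
            ((K : ℝ) / D - ⌊(K : ℝ) / D⌋₊) * (1 / (N : ℝ) ^ ⌊(K : ℝ) / D⌋₊))⁻¹)) := by
  refine ⟨fun hF => ?_, fun h => ?_, fun _ => ?_⟩
  · subst hN
    have : Nonempty (Fin D) := ⟨⟨0, by omega⟩⟩
    obtain ⟨j₀, hj₀⟩ := exists_eq_ciSup_of_finite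
      (f := fun j : Fin D => MPIR.Fvec K D j / MPIR.Gvec K D j)
    rw [← hj₀]
    exact MPIR.le_linearCapacity hF hm hDK j₀
  · exact MPIR.linearCapacity_le_of_half_le hDK hm (by omega) (by omega) h
  · exact MPIR.linearCapacity_le_of_le_half hDK hm (by omega) (by omega)
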